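/- Let $H_S\in\mathbb C^{n\times n}$ be Hermitian, and assume that there are $E_1\in\mathbb R$ and $\Delta E>0$ such that $\sigma(H_S)\subseteq\{E_1+j\Delta E: j\in\mathbb N_0\}$. For a finite temperature $T>0$, $m\geq 1$, a Hermitian matrix $H_B\in\mathbb C^{m\times m}$ and a unitary $U\in\mathbb C^{nm\times nm}$, define the linear map on $\mathbb C^{n\times n}$ $$\Phi_{T,m}(H_B,U)(A)=\operatorname{tr}_B\Big(U\Big(A\otimes \frac{e^{-H_B/T}}{\operatorname{tr}(e^{-H_B/T})}\Big)U^*\Big),$$ where $\operatorname{tr}_B$ is the partial trace over the second factor of $\mathbb C^n\otimes\mathbb C^m$; for $T=\infty$ set $\Phi_{\infty,m}(H_B,U):=\Phi_{1,m}(\mathbb 1_m,U)$, so that the Gibbs state is replaced by $\mathbb 1_m/m$. For $T\in(0,\infty]$ let $$\mathsf{TO}(H_S,T)=\bigcup_{m\ge1}\Big\{\Phi_{T,m}(H_B,U):\ H_B \text{ Hermitian},\ U\text{ unitary},\ U(H_S\otimes\mathbb 1+\mathbb 1\otimes H_B)U^*=H_S\otimes\mathbb 1+\mathbb 1\otimes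 H_B\Big\}.$$ For $\beta=(\beta_1,\dots,\beta_m)\in\mathbb N_0^m$ with $|\beta|:=\sum_j\beta_j>0$ put $H_\beta=\bigoplus_{j=1}^m j\,\Delta E\,\mathbb 1_{\beta_j}$ and $$\mathcal S_\beta(T)=\Big\{\Phi_{T,|\beta|}\big(H_\beta,e^{iH_{\mathsf{tot}}}\big):\ H_{\mathsf{tot}}\text{ Hermitian of size } n|\beta|,\ [H_{\mathsf{tot}},H_S\otimes\mathbb 1+\mathbb 1\otimes H_\beta]=0\Big\}.$$ Define $\mathsf{TO}^{\Delta E}_{\mathsf{Spin}}(H_S,T)=\bigcup_{m\ge 1}\bigcup_{\beta_1,\dots,\beta_m\ge 1}\mathcal S_\beta(T)$. Then for every $T\in(0,\infty]$, with closures taken in the space of linear maps on $\mathbb C^{n\times n}$, $$\overline{\mathsf{TO}^{\Delta E}_{\mathsf{Spin}}(H_S,T)}=\overline{\bigcup_{m\ge 1}\ \bigcup_{\beta\in\mathbb N_0^m,\ |\beta|>0}\mathcal S_\beta(T)}\qquad\text{and}\qquad \overline{\mathsf{TO}(H_S,T)}=\overline{\mathsf{TO}^{\Delta E}_{\mathsf{Spin}}(H_S,T)}.$$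 -/

import Mathlib

open scoped Kronecker ENNReal

noncomputable section

/-- The partial trace `tr_B` over the second tensor factor: `(tr_B X) i j = ∑ k, X (i, k) (j, k)`. -/
def partialTraceBath {s b : Type*} [Fintype b] (X : Matrix (s × b) (s × b) ℂ) : Matrix s s ℂ :=
  Matrix.of fun i j => ∑ k, X (i, k) (j, k)

/-- The Gibbs state `e^{-H/T} / tr (e^{-H/T})` at finite temperature `T`. -/
def gibbsState {b : Type*} [Fintype b] [DecidableEq b] (T : ℝ) (H : Matrix b b ℂ) :
    Matrix b b ℂ :=
  (NormedSpace.exp (-(T⁻¹ • H))).trace⁻¹ • NormedSpace.exp (-(T⁻¹ • H))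

/-- The linear map `Φ_T(H_B, U) : A ↦ tr_B (U (A ⊗ e^{-H_B/T} / tr (e^{-H_B/T})) U*)`. -/
def bathMap {n : ℕ} {b : Type*} [Fintype b] [DecidableEq b] (T : ℝ) (HB : Matrix b b ℂ)
    (U : Matrix (Fin n × b) (Fin n × b) ℂ) :
    Matrix (Fin n) (Fin n) ℂ →ₗ[ℂ] Matrix (Fin n) (Fin n) ℂ where
  toFun A := partialTraceBath (U * (A ⊗ₖ gibbsState T HB) * U.conjTranspose)
  map_add' A A' := by
    ext i j
    simp [partialTraceBath, Matrix.add_kronecker, Matrix.mul_add, Matrix.add_mul,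
      Finset.sum_add_distrib]
  map_smul' c A := by
    ext i j
    simp [partialTraceBath, Matrix.smul_kronecker, Finset.mul_sum]

/-- The map generated by the bath Hamiltonian `HB` and the unitary `U` at temperature
`T ∈ (0, ∞]`: this is `Φ_T(H_B, U)` for finite `T`, and `Φ_1(1, U)`, i.e. the bath is in the
maximally mixed state, for `T = ∞`. It is bundled as an element of the (finite-dimensional) space
of continuous linear maps, which carries the operator-norm topology. -/
def thermalMap {n : ℕ} {b : Type*} [Fintype b] [DecidableEq b] (T : ℝ≥0∞) (HB : Matrix b b ℂ)
    (U : Matrix (Fin n × b) (Fin n × b) ℂ) :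
    Matrix (Fin n) (Fin n) ℂ →L[ℂ] Matrix (Fin n) (Fin n) ℂ :=
  LinearMap.toContinuousLinearMap (if T = ⊤ then bathMap 1 1 U else bathMap T.toReal HB U)

/-- The uncoupled total Hamiltonian `H_S ⊗ 1 + 1 ⊗ H_B`. -/
def freeHamiltonian {n : ℕ} {b : Type*} [DecidableEq b]
    (HS : Matrix (Fin n) (Fin n) ℂ) (HB : Matrix b b ℂ) :
    Matrix (Fin n × b) (Fin n × b) ℂ :=
  HS ⊗ₖ (1 : Matrix b b ℂ) + (1 : Matrix (Fin n) (Fin n) ℂ) ⊗ₖ HB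

/-- The thermal operations `TO(H_S, T)`. -/
def thermalOperations {n : ℕ} (HS : Matrix (Fin n) (Fin n) ℂ) (T : ℝ≥0∞) :
    Set (Matrix (Fin n) (Fin n) ℂ →L[ℂ] Matrix (Fin n) (Fin n) ℂ) :=
  {S | ∃ (m : ℕ) (HB : Matrix (Fin m) (Fin m) ℂ)
      (U : Matrix (Fin n × Fin m) (Fin n × Fin m) ℂ),
    0 < m ∧ HB.IsHermitian ∧ U ∈ Matrix.unitaryGroup (Fin n × Fin m) ℂ ∧
    U * freeHamiltonian HS HB * U.conjTranspose = freeHamiltonian HS HB ∧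
    S = thermalMap T HB U}

/-- The spin Hamiltonian `⊕_{j=1}^m j ΔE 1_{β_j}`; the index `j : Fin m` stands for `j + 1`. -/
def spinHamiltonian (ΔE : ℝ) {m : ℕ} (β : Fin m → ℕ) :
    Matrix (Σ j : Fin m, Fin (β j)) (Σ j : Fin m, Fin (β j)) ℂ :=
  Matrix.blockDiagonal' fun j : Fin m =>
    (((j : ℕ) + 1 : ℝ) * ΔE) • (1 : Matrix (Fin (β j)) (Fin (β j)) ℂ)

/-- The maps generated by the spin bath with gap `ΔE` and degeneracies `β`, together with
`e^{i H_tot}` for some Hermitian `H_tot` that commutes with `H_S ⊗ 1 + 1 ⊗ H_B`. -/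
def spinBathOperations {n : ℕ} (HS : Matrix (Fin n) (Fin n) ℂ) (ΔE : ℝ) (T : ℝ≥0∞) {m : ℕ}
    (β : Fin m → ℕ) : Set (Matrix (Fin n) (Fin n) ℂ →L[ℂ] Matrix (Fin n) (Fin n) ℂ) :=
  {S | ∃ Htot : Matrix (Fin n × Σ j : Fin m, Fin (β j)) (Fin n × Σ j : Fin m, Fin (β j)) ℂ,
    Htot.IsHermitian ∧ ⁅Htot, freeHamiltonian HS (spinHamiltonian ΔE β)⁆ = 0 ∧
    S = thermalMap T (spinHamiltonian ΔE β) (NormedSpace.exp (Complex.I • Htot))}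

/-- `TO_Spin^{ΔE}(H_S, T)`: all degeneracies are positive. -/
def spinThermalOperations {n : ℕ} (HS : Matrix (Fin n) (Fin n) ℂ) (ΔE : ℝ) (T : ℝ≥0∞) :
    Set (Matrix (Fin n) (Fin n) ℂ →L[ℂ] Matrix (Fin n) (Fin n) ℂ) :=
  {S | ∃ (m : ℕ) (β : Fin m → ℕ), 0 < m ∧ (∀ j, 0 < β j) ∧ S ∈ spinBathOperations HS ΔE T β}

/-- The variant in which degeneracies may vanish, as long as not all of them do. -/
def spinThermalOperationsWithGaps {n : ℕ} (HS : Matrix (Fin n) (Fin n) ℂ) (ΔE : ℝ) (T : ℝ≥0∞) :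
    Set (Matrix (Fin n) (Fin n) ℂ →L[ℂ] Matrix (Fin n) (Fin n) ℂ) :=
  {S | ∃ (m : ℕ) (β : Fin m → ℕ), 0 < m ∧ 0 < ∑ j, β j ∧ S ∈ spinBathOperations HS ΔE T β}

end

/-! Spin operations lie among those with gaps, which lie among all thermal operations; it remains to
approximate a thermal operation by spin ones. Diagonalise the bath and cut `U` into blocks `B l k`
acting on the system. The map is then the mixture of `A ↦ ∑ l, B l k * A * (B l k)ᴴ` with Boltzmann
weights, and energy conservation reads `[HS, B l k] = (e k - e l) B l k`. As the levels of `HS` lie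
on a ladder of spacing `ΔE`, a nonzero block forces `e k - e l ∈ ℤ ΔE`
(`exists_int_eq_of_commutator_eq_smul`). So `e k = r k + (E k + 1) ΔE`, with `r` constant along
nonzero blocks (`IsEnergyConserving.exists_levels`). Dropping `r` keeps energy conservation but
loses the weight `exp (-r k / T)`. Degeneracy restores it: level `k` is repeated about `M exp (-r k
/ T)` times (`amplify`), the same number for coupled levels. One idle copy of every ladder level
(`sumBlocks`) removes gaps, at a relative weight that vanishes as `M → ∞`. -/

open Matrix in
/-- Every unitary matrix commuting with a matrix `K` is `exp (i H)` for a Hermitian matrix `H`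
commuting with `K`. -/
theorem exists_isHermitian_exp_eq {ι : Type*} [Fintype ι] [DecidableEq ι] {U K : Matrix ι ι ℂ}
    (hU : U ∈ unitaryGroup ι ℂ) (hK : Commute U K) :
    ∃ H : Matrix ι ι ℂ, H.IsHermitian ∧ Commute H K ∧ NormedSpace.exp (Complex.I • H) = U := by
  open scoped Matrix.Norms.L2Operator in
  have hn : IsStarNormal U := ⟨by
    rw [commute_iff_eq, mem_unitaryGroup_iff.1 hU, mem_unitaryGroup_iff'.1 hU]⟩
  have hfin : (spectrum ℂ U).Finite := U.finite_spectrum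
  -- The argument jumps on the negative axis, but on a finite spectrum every function is continuous.
  have hcont (f : ℂ → ℂ) : ContinuousOn f (spectrum ℂ U) := hfin.continuousOn f
  have hK' : Commute (star U) K := by
    have h1 := mem_unitaryGroup_iff.1 hU
    have h2 := mem_unitaryGroup_iff'.1 hU
    calc star U * K = star U * K * (U * star U) := by rw [h1, mul_one]
      _ = star U * (K * U) * star U := by simp only [mul_assoc]
      _ = star U * U * (K * star U) := by rw [← hK.eq]; simp only [mul_assoc]
      _ = K * star U := by rw [h2, one_mul]
  refine ⟨cfc (fun z : ℂ => (z.arg : ℂ)) U, ?_, hK.cfc hK' _, ?_⟩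
  · change star _ = _
    rw [← cfc_star]
    simp
  · rw [← cfc_smul Complex.I _ U (hcont _), ← CFC.complex_exp_eq_normedSpace_exp, ← cfc_comp' _ _ U
      (((hfin.image _)).continuousOn _) (hcont _)]
    conv_rhs => rw [← cfc_id' ℂ U]
    refine cfc_congr fun z hz => ?_
    have hz1 : ‖z‖ = 1 := by
      exact spectrum.norm_eq_one_of_unitary hU hz
    have := Complex.norm_mul_exp_arg_mul_I z
    rw [hz1, Complex.ofReal_one, one_mul, mul_comm] at this
    simpa using this

/-! ### Block form over the bath. -/

section

open Matrix Filter Topology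

variable {n : ℕ} {b c : Type*}

/-- The matrix on `ℂⁿ ⊗ ℂᵇ` with the given blocks. -/
def ofBlocks (B : b → b → Matrix (Fin n) (Fin n) ℂ) : Matrix (Fin n × b) (Fin n × b) ℂ :=
  of fun p q => B p.2 q.2 p.1 q.1

/-- The blocks of a matrix on `ℂⁿ ⊗ ℂᵇ`. -/
def blocks (U : Matrix (Fin n × b) (Fin n × b) ℂ) (l k : b) : Matrix (Fin n) (Fin n) ℂ :=
  of fun i j => U (i, l) (j, k)

theorem ofBlocks_blocks (U : Matrix (Fin n × b) (Fin n × b) ℂ) : ofBlocks (blocks U) = U := rfl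

theorem ofBlocks_injective : Function.Injective (ofBlocks (n := n) (b := b)) := fun B C h => by
  funext l k
  ext i j
  exact congrFun (congrFun h (i, l)) (j, k)

theorem conjTranspose_ofBlocks (B : b → b → Matrix (Fin n) (Fin n) ℂ) :
    (ofBlocks B)ᴴ = ofBlocks fun l k => (B k l)ᴴ := rfl

theorem ofBlocks_one [DecidableEq b] :
    ofBlocks (fun l k : b => if l = k then (1 : Matrix (Fin n) (Fin n) ℂ) else 0) = 1 := by
  ext ⟨i, l⟩ ⟨j, k⟩
  by_cases h : l = k <;> simp [ofBlocks, one_apply, h]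

theorem freeHamiltonian_diagonal [DecidableEq b] (HS : Matrix (Fin n) (Fin n) ℂ) (e : b → ℂ) :
    freeHamiltonian HS (diagonal e) =
      ofBlocks fun l k => if l = k then HS + e l • 1 else 0 := by
  ext ⟨i, l⟩ ⟨j, k⟩
  by_cases h : l = k
  · by_cases h' : i = j <;> simp [freeHamiltonian, ofBlocks, h, h']
  · simp [freeHamiltonian, ofBlocks, h]

variable [Fintype b] [Fintype c]

theorem ofBlocks_mul (B C : b → b → Matrix (Fin n) (Fin n) ℂ) :
    ofBlocks B * ofBlocks C = ofBlocks fun l k => ∑ m, B l m * C m k := by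
  ext ⟨i, l⟩ ⟨j, k⟩
  simp only [ofBlocks, mul_apply, of_apply, Fintype.sum_prod_type, Matrix.sum_apply]
  exact Finset.sum_comm

variable [DecidableEq b] [DecidableEq c]

theorem ofBlocks_mem_unitaryGroup_iff (B : b → b → Matrix (Fin n) (Fin n) ℂ) :
    ofBlocks B ∈ unitaryGroup (Fin n × b) ℂ ↔
      ∀ l k, ∑ m, B l m * (B k m)ᴴ = if l = k then 1 else 0 := by
  rw [mem_unitaryGroup_iff, star_eq_conjTranspose, conjTranspose_ofBlocks, ofBlocks_mul,
    ← ofBlocks_one, ofBlocks_injective.eq_iff, funext_iff]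
  simp only [funext_iff]

theorem commute_ofBlocks_freeHamiltonian_iff (B : b → b → Matrix (Fin n) (Fin n) ℂ)
    (HS : Matrix (Fin n) (Fin n) ℂ) (e : b → ℂ) :
    Commute (ofBlocks B) (freeHamiltonian HS (diagonal e)) ↔
      ∀ l k, HS * B l k - B l k * HS = (e k - e l) • B l k := by
  rw [freeHamiltonian_diagonal, commute_iff_eq, ofBlocks_mul, ofBlocks_mul,
    ofBlocks_injective.eq_iff, funext_iff]
  simp only [funext_iff, mul_ite, mul_zero, ite_mul, zero_mul, Finset.sum_ite_eq,
    Finset.sum_ite_eq', Finset.mem_univ, if_true]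
  refine forall_congr' fun l => forall_congr' fun k => ?_
  rw [mul_add, add_mul, Matrix.mul_smul, Matrix.smul_mul, mul_one, one_mul, sub_smul, sub_eq_sub_iff_add_eq_add,
    add_comm (B l k * HS), eq_comm, add_comm (e k • _)]

/-! ### Kraus form of thermal maps. -/

/-- The completely positive map `A ↦ ∑ l, B l k * A * (B l k)ᴴ` with Kraus operators the blocks
in column `k`. -/
noncomputable def krausMap (B : b → b → Matrix (Fin n) (Fin n) ℂ) (k : b) :
    Matrix (Fin n) (Fin n) ℂ →L[ℂ] Matrix (Fin n) (Fin n) ℂ :=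
  LinearMap.toContinuousLinearMap
    (∑ l, LinearMap.mulLeftRight ℂ (B l k, (B l k)ᴴ))

omit [DecidableEq b] in
theorem krausMap_apply (B : b → b → Matrix (Fin n) (Fin n) ℂ) (k : b)
    (A : Matrix (Fin n) (Fin n) ℂ) : krausMap B k A = ∑ l, B l k * A * (B l k)ᴴ := by
  simp [krausMap]

/-- The mixture of the maps `krausMap B k` with weights proportional to `w k`. -/
noncomputable def krausMixture (w : b → ℂ) (B : b → b → Matrix (Fin n) (Fin n) ℂ) :
    Matrix (Fin n) (Fin n) ℂ →L[ℂ] Matrix (Fin n) (Fin n) ℂ :=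
  (∑ k, w k)⁻¹ • ∑ k, w k • krausMap B k

omit [DecidableEq b] in
theorem krausMixture_apply (w : b → ℂ) (B : b → b → Matrix (Fin n) (Fin n) ℂ)
    (A : Matrix (Fin n) (Fin n) ℂ) :
    krausMixture w B A = (∑ k, w k)⁻¹ • ∑ k, w k • krausMap B k A := by
  simp [krausMixture]

omit [DecidableEq b] [DecidableEq c] in
theorem krausMixture_comp_equiv (σ : c ≃ b) (w : b → ℂ) (B : b → b → Matrix (Fin n) (Fin n) ℂ) :
    krausMixture (fun k => w (σ k)) (fun l k => B (σ l) (σ k)) = krausMixture w B := by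
  unfold krausMixture
  rw [σ.sum_comp w, ← σ.sum_comp fun k => w k • krausMap B k]
  congr! 3 with k
  ext1 A
  rw [krausMap_apply, krausMap_apply, ← σ.sum_comp]

omit [DecidableEq b] in
theorem partialTraceBath_ofBlocks (M : b → b → Matrix (Fin n) (Fin n) ℂ) :
    partialTraceBath (ofBlocks M) = ∑ l, M l l := by
  ext i j
  simp [partialTraceBath, ofBlocks, Matrix.sum_apply]

theorem partialTraceBath_conj_ofBlocks (B : b → b → Matrix (Fin n) (Fin n) ℂ)
    (A : Matrix (Fin n) (Fin n) ℂ) (w : b → ℂ) (z : ℂ) :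
    partialTraceBath (ofBlocks B * (A ⊗ₖ (z • diagonal w)) * (ofBlocks B)ᴴ) =
      z • ∑ k, w k • ∑ l, B l k * A * (B l k)ᴴ := by
  have h : A ⊗ₖ (z • diagonal w) = ofBlocks fun l k => if l = k then (z * w l) • A else 0 := by
    ext ⟨i, l⟩ ⟨j, k⟩
    by_cases h : l = k <;> simp [ofBlocks, h, mul_comm]
  rw [h, conjTranspose_ofBlocks, ofBlocks_mul, ofBlocks_mul]
  simp only [partialTraceBath_ofBlocks, mul_ite, mul_zero, Finset.sum_ite_eq', Finset.mem_univ, if_true, Finset.smul_sum,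
    mul_smul_comm, smul_mul_assoc, smul_smul]
  exact Finset.sum_comm

/-- The Boltzmann factors of the bath energies `e`; they are all `1` if `T = ∞`. -/
noncomputable def boltzmann (T : ℝ≥0∞) (e : b → ℝ) (k : b) : ℝ := Real.exp (-(T⁻¹.toReal * e k))

theorem thermalMap_diagonal (T : ℝ≥0∞) (e : b → ℝ) (B : b → b → Matrix (Fin n) (Fin n) ℂ) :
    thermalMap T (diagonal fun k => (e k : ℂ)) (ofBlocks B) =
      krausMixture (fun k => (boltzmann T e k : ℂ)) B := by
  have key (t : ℝ) (f : b → ℝ) : gibbsState t (diagonal fun k => (f k : ℂ)) =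
      (∑ k, (Real.exp (-(t⁻¹ * f k)) : ℂ))⁻¹ •
        diagonal fun k => (Real.exp (-(t⁻¹ * f k)) : ℂ) := by
    have : NormedSpace.exp (-(t⁻¹ • diagonal fun k => (f k : ℂ))) =
        diagonal fun k => (Real.exp (-(t⁻¹ * f k)) : ℂ) := by
      rw [← diagonal_smul, diagonal_neg, exp_diagonal]
      congr 1
      funext k
      rw [Pi.coe_exp, ← Complex.exp_eq_exp_ℂ]
      simp
    rw [gibbsState, this, trace_diagonal]
  ext1 A
  have : krausMixture (fun k => (boltzmann T e k : ℂ)) B A =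
      (∑ k, (boltzmann T e k : ℂ))⁻¹ •
        ∑ k, (boltzmann T e k : ℂ) • ∑ l, B l k * A * (B l k)ᴴ := by
    simp only [krausMixture_apply, krausMap_apply]
  rw [this, ← partialTraceBath_conj_ofBlocks]
  by_cases hT : T = ⊤
  -- At `T = ∞` the bath Hamiltonian is `1`, so all Gibbs weights are `exp (-1)`, which cancels on
  -- normalising.
  · have h := key 1 (fun _ : b => 1)
    simp only [Complex.ofReal_one, diagonal_one] at h
    have h' : gibbsState 1 (1 : Matrix b b ℂ) =
        (∑ k, (boltzmann T e k : ℂ))⁻¹ • diagonal fun k => (boltzmann T e k : ℂ) := by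
      rw [h]
      ext i j
      by_cases hij : i = j
      · simp [hij, boltzmann, hT, _root_.mul_inv_rev]
        rw [mul_right_comm, inv_mul_cancel₀ (Complex.exp_ne_zero _), one_mul]
      · simp [hij]
    rw [thermalMap, if_pos hT, ← h']
    rfl
  · have h := key T.toReal e
    simp only [← ENNReal.toReal_inv] at h
    rw [thermalMap, if_neg hT]
    simp only [boltzmann]
    rw [← h]
    rfl

omit [DecidableEq b] in
theorem boltzmann_sum_ne_zero [Nonempty b] (T : ℝ≥0∞) (e : b → ℝ) :
    (∑ k, (boltzmann T e k : ℂ)) ≠ 0 := by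
  rw [← Complex.ofReal_sum, Complex.ofReal_ne_zero]
  exact (Finset.sum_pos (fun k _ => Real.exp_pos _) Finset.univ_nonempty).ne'

/-- The Gibbs state is covariant under `V`, and the partial trace ignores unitaries on the bath.
This allows a diagonal bath Hamiltonian. -/
theorem thermalMap_conj (T : ℝ≥0∞) (HB V : Matrix b b ℂ) (hV : V ∈ unitaryGroup b ℂ)
    (U : Matrix (Fin n × b) (Fin n × b) ℂ) :
    thermalMap T (V * HB * Vᴴ) U = thermalMap T HB ((1 ⊗ₖ V)ᴴ * U * (1 ⊗ₖ V)) := by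
  have hVr : V * Vᴴ = 1 := mem_unitaryGroup_iff.1 hV
  have hVl : Vᴴ * V = 1 := mem_unitaryGroup_iff'.1 hV
  have hinv : Vᴴ = V⁻¹ := (inv_eq_left_inv hVl).symm
  have hg (t : ℝ) (H : Matrix b b ℂ) : gibbsState t (V * H * Vᴴ) = V * gibbsState t H * Vᴴ := by
    have h : -(t⁻¹ • (V * H * Vᴴ)) = V * (-(t⁻¹ • H)) * V⁻¹ := by simp [hinv]
    rw [gibbsState, h, exp_conj _ _ (IsUnit.of_mul_eq_one _ hVr), trace_mul_cycle, ← hinv, hVl,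
      one_mul, gibbsState]
    simp
  have htr (X : Matrix (Fin n × b) (Fin n × b) ℂ) :
      partialTraceBath ((1 ⊗ₖ V)ᴴ * X * (1 ⊗ₖ V)) = partialTraceBath X := by
    have h1 : (1 : Matrix (Fin n) (Fin n) ℂ) ⊗ₖ V = ofBlocks fun l k => V l k • 1 := by
      ext ⟨i, l⟩ ⟨j, k⟩
      simp [ofBlocks, mul_comm]
    rw [h1, conjTranspose_ofBlocks, ← ofBlocks_blocks X, ofBlocks_mul, ofBlocks_mul,
      partialTraceBath_ofBlocks, partialTraceBath_ofBlocks]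
    simp only [conjTranspose_smul, conjTranspose_one, smul_mul_assoc, one_mul, Finset.smul_sum,
      mul_smul_comm, mul_one, smul_smul]
    calc ∑ k, ∑ m, ∑ l, (V m k * star (V l k)) • blocks X l m
        = ∑ m, ∑ l, (V * Vᴴ) m l • blocks X l m := by
          simp only [mul_apply, Finset.sum_smul, conjTranspose_apply]
          rw [Finset.sum_comm]
          exact Finset.sum_congr rfl fun m _ => Finset.sum_comm
      _ = ∑ l, blocks X l l := by simp [hVr, one_apply]
  have main (t : ℝ) (H : Matrix b b ℂ) :
      bathMap t (V * H * Vᴴ) U = bathMap t H ((1 ⊗ₖ V)ᴴ * U * (1 ⊗ₖ V)) := by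
    ext1 A
    have hA : A ⊗ₖ (V * gibbsState t H * Vᴴ) =
        (1 ⊗ₖ V) * (A ⊗ₖ gibbsState t H) * (1 ⊗ₖ V)ᴴ := by
      rw [conjTranspose_kronecker, ← mul_kronecker_mul, ← mul_kronecker_mul]
      simp
    simp only [bathMap, LinearMap.coe_mk, AddHom.coe_mk, hg, hA, conjTranspose_mul,
      conjTranspose_conjTranspose]
    rw [← htr]
    simp only [Matrix.mul_assoc]
  unfold thermalMap
  split_ifs
  · have := main 1 1
    rw [mul_one, hVr] at this
    rw [this]
  · rw [main]

/-! ### Energy-conserving blocks and the two classes of operations. -/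

variable {HS : Matrix (Fin n) (Fin n) ℂ} {T : ℝ≥0∞}

/-- The matrix with blocks `B` is unitary and commutes with the uncoupled Hamiltonian of `HS` and a
bath with energies `e`. -/
structure IsEnergyConserving (HS : Matrix (Fin n) (Fin n) ℂ) (e : b → ℝ)
    (B : b → b → Matrix (Fin n) (Fin n) ℂ) : Prop where
  unitary : ∀ l k, ∑ m, B l m * (B k m)ᴴ = if l = k then 1 else 0
  commute : ∀ l k, HS * B l k - B l k * HS = ((e k : ℂ) - e l) • B l k

theorem isEnergyConserving_iff (e : b → ℝ) (B : b → b → Matrix (Fin n) (Fin n) ℂ) :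
    IsEnergyConserving HS e B ↔ ofBlocks B ∈ unitaryGroup (Fin n × b) ℂ ∧
      Commute (ofBlocks B) (freeHamiltonian HS (diagonal fun k => (e k : ℂ))) := by
  rw [ofBlocks_mem_unitaryGroup_iff, commute_ofBlocks_freeHamiltonian_iff]
  exact ⟨fun h => ⟨h.1, h.2⟩, fun h => ⟨h.1, h.2⟩⟩

theorem IsEnergyConserving.comp_equiv {e : b → ℝ} {B : b → b → Matrix (Fin n) (Fin n) ℂ}
    (h : IsEnergyConserving HS e B) (σ : c ≃ b) :
    IsEnergyConserving HS (fun k => e (σ k)) (fun l k => B (σ l) (σ k)) where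
  unitary l k := by
    rw [σ.sum_comp fun m => B (σ l) m * (B (σ k) m)ᴴ, h.unitary]
    simp
  commute l k := h.commute _ _

theorem commute_iff_conj_eq {ι : Type*} [Fintype ι] [DecidableEq ι] {U K : Matrix ι ι ℂ}
    (hU : U ∈ unitaryGroup ι ℂ) : Commute U K ↔ U * K * Uᴴ = K := by
  have hr : U * Uᴴ = 1 := mem_unitaryGroup_iff.1 hU
  have hl : Uᴴ * U = 1 := mem_unitaryGroup_iff'.1 hU
  constructor
  · intro h
    rw [h.eq, Matrix.mul_assoc, hr, Matrix.mul_one]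
  · intro h
    rw [commute_iff_eq]
    conv_rhs => rw [← h]
    rw [Matrix.mul_assoc, hl, Matrix.mul_one]

theorem IsEnergyConserving.mem_thermalOperations [Nonempty b] {e : b → ℝ}
    {B : b → b → Matrix (Fin n) (Fin n) ℂ} (h : IsEnergyConserving HS e B) :
    krausMixture (fun k => (boltzmann T e k : ℂ)) B ∈ thermalOperations HS T := by
  have σ := (Fintype.equivFin b).symm
  have h' := h.comp_equiv σ
  have hU := (isEnergyConserving_iff _ _).1 h'
  refine ⟨_, diagonal fun k => (e (σ k) : ℂ), _, Fintype.card_pos, ?_, hU.1,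
    (commute_iff_conj_eq hU.1).1 hU.2, ?_⟩
  · exact isHermitian_diagonal_iff.2 fun i => Complex.conj_ofReal _
  · rw [thermalMap_diagonal, ← krausMixture_comp_equiv σ]
    rfl

theorem exists_isEnergyConserving_of_mem_thermalOperations
    {S : Matrix (Fin n) (Fin n) ℂ →L[ℂ] Matrix (Fin n) (Fin n) ℂ}
    (hS : S ∈ thermalOperations HS T) :
    ∃ (m : ℕ) (e : Fin m → ℝ) (B : Fin m → Fin m → Matrix (Fin n) (Fin n) ℂ), 0 < m ∧
      IsEnergyConserving HS e B ∧ S = krausMixture (fun k => (boltzmann T e k : ℂ)) B := by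
  obtain ⟨m, HB, U, hm, hHB, hU, hcomm, rfl⟩ := hS
  have hspec := hHB.spectral_theorem
  set V : Matrix (Fin m) (Fin m) ℂ := hHB.eigenvectorUnitary.1 with hVdef
  set D : Matrix (Fin m) (Fin m) ℂ := diagonal fun k => (hHB.eigenvalues k : ℂ) with hD
  have hV : V ∈ unitaryGroup (Fin m) ℂ := hHB.eigenvectorUnitary.2
  have hspec' : HB = V * D * Vᴴ := hspec
  set W : Matrix (Fin n × Fin m) (Fin n × Fin m) ℂ := 1 ⊗ₖ V with hWdef
  have hW : W ∈ unitaryGroup (Fin n × Fin m) ℂ := kronecker_mem_unitary (one_mem _) hV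
  have hWr : W * Wᴴ = 1 := mem_unitaryGroup_iff.1 hW
  have hWl : Wᴴ * W = 1 := mem_unitaryGroup_iff'.1 hW
  have hF : freeHamiltonian HS HB = W * freeHamiltonian HS D * Wᴴ := by
    have hVr : V * Vᴴ = 1 := mem_unitaryGroup_iff.1 hV
    rw [freeHamiltonian, freeHamiltonian, hspec', hWdef, conjTranspose_kronecker, Matrix.mul_add,
      Matrix.add_mul]
    simp only [← mul_kronecker_mul]
    simp [hVr]
  refine ⟨m, hHB.eigenvalues, blocks (Wᴴ * U * W), hm, ?_, ?_⟩
  · rw [isEnergyConserving_iff, ofBlocks_blocks]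
    refine ⟨mul_mem (mul_mem (Unitary.star_mem hW) hU) hW, ?_⟩
    have hc := (commute_iff_conj_eq hU).2 hcomm
    rw [hF] at hc
    change _ = _
    calc Wᴴ * U * W * freeHamiltonian HS D
        = Wᴴ * (U * (W * freeHamiltonian HS D * Wᴴ)) * W := by
          simp only [Matrix.mul_assoc, hWl, Matrix.mul_one]
      _ = (Wᴴ * W) * freeHamiltonian HS D * (Wᴴ * U * W) := by
          rw [hc.eq]; simp only [Matrix.mul_assoc]
      _ = _ := by rw [hWl, Matrix.one_mul]
  · rw [← thermalMap_diagonal, ofBlocks_blocks, ← thermalMap_conj T _ V hV, ← hspec']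

theorem spinHamiltonian_eq_diagonal (ΔE : ℝ) {m : ℕ} (β : Fin m → ℕ) :
    spinHamiltonian ΔE β = diagonal fun k => ((((k.1 : ℕ) + 1) * ΔE : ℝ) : ℂ) := by
  ext ⟨j, x⟩ ⟨j', x'⟩
  by_cases h : j = j'
  · subst h
    by_cases hx : x = x' <;> simp [spinHamiltonian, blockDiagonal'_apply, hx]
  · simp [spinHamiltonian, blockDiagonal'_apply, h]

theorem mem_spinBathOperations_iff {ΔE : ℝ} {m : ℕ} {β : Fin m → ℕ}
    {S : Matrix (Fin n) (Fin n) ℂ →L[ℂ] Matrix (Fin n) (Fin n) ℂ} :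
    S ∈ spinBathOperations HS ΔE T β ↔
      ∃ B, IsEnergyConserving HS (fun k : Σ j : Fin m, Fin (β j) => ((k.1 : ℕ) + 1) * ΔE) B ∧
        S = krausMixture (fun k => (boltzmann T
          (fun k : Σ j : Fin m, Fin (β j) => ((k.1 : ℕ) + 1) * ΔE) k : ℂ)) B := by
  simp only [spinBathOperations, Set.mem_ofPred_eq, isEnergyConserving_iff,
    spinHamiltonian_eq_diagonal]
  constructor
  · rintro ⟨H, hH, hc, rfl⟩
    refine ⟨blocks (NormedSpace.exp (Complex.I • H)), ?_, ?_⟩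
    · rw [ofBlocks_blocks]
      refine ⟨?_, ?_⟩
      · rw [mem_unitaryGroup_iff, star_eq_conjTranspose, ← exp_conjTranspose, conjTranspose_smul,
          hH.eq, ← exp_add_of_commute]
        · simp
        · exact ((Commute.refl H).smul_left _).smul_right _
      · exact Commute.exp_left ((commute_iff_lie_eq.2 hc).smul_left _)
    · rw [← thermalMap_diagonal, ofBlocks_blocks]
  · rintro ⟨B, ⟨hB, hc⟩, rfl⟩
    obtain ⟨H, hH, hHc, hexp⟩ := exists_isHermitian_exp_eq hB hc
    refine ⟨H, hH, commute_iff_lie_eq.1 hHc, ?_⟩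
    rw [hexp, thermalMap_diagonal]

/-- Grouping the bath states by level gives degeneracies equal to the fibre sizes of `E`;
surjectivity makes them positive. -/
theorem IsEnergyConserving.mem_spinThermalOperations {ΔE : ℝ} {J : ℕ} (hJ : 0 < J) {E : b → Fin J}
    (hE : Function.Surjective E) {B : b → b → Matrix (Fin n) (Fin n) ℂ}
    (h : IsEnergyConserving HS (fun k => ((E k : ℕ) + 1) * ΔE) B) :
    krausMixture (fun k => (boltzmann T (fun k => ((E k : ℕ) + 1) * ΔE) k : ℂ)) B ∈
      spinThermalOperations HS ΔE T := by
  let σ : (Σ j : Fin J, Fin (Fintype.card {x // E x = j})) ≃ b :=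
    (Equiv.sigmaCongrRight fun j => (Fintype.equivFin {x // E x = j}).symm).trans
      (Equiv.sigmaFiberEquiv E)
  have hσ (x) : E (σ x) = x.1 := ((Fintype.equivFin {y // E y = x.1}).symm x.2).2
  refine ⟨J, fun j => Fintype.card {x // E x = j}, hJ, fun j => ?_, ?_⟩
  · obtain ⟨x, hx⟩ := hE j
    exact Fintype.card_pos_iff.2 ⟨⟨x, hx⟩⟩
  · rw [mem_spinBathOperations_iff]
    refine ⟨fun l k => B (σ l) (σ k), ?_, (krausMixture_comp_equiv σ _ _).symm.trans ?_⟩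
    · simpa only [hσ] using h.comp_equiv σ
    · simp only [boltzmann, hσ]

/-! ### Enlarging the bath: idle levels and repeated levels. -/

/-- The blocks of the direct sum of the matrix with blocks `B` and the identity. -/
def sumBlocks (c : Type*) [DecidableEq c] (B : b → b → Matrix (Fin n) (Fin n) ℂ) :
    b ⊕ c → b ⊕ c → Matrix (Fin n) (Fin n) ℂ
  | .inl l, .inl k => B l k
  | .inr l, .inr k => if l = k then 1 else 0
  | .inl _, .inr _ => 0
  | .inr _, .inl _ => 0

theorem IsEnergyConserving.sumBlocks {e : b → ℝ} {B : b → b → Matrix (Fin n) (Fin n) ℂ}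
    (h : IsEnergyConserving HS e B) (f : c → ℝ) :
    IsEnergyConserving HS (Sum.elim e f) (sumBlocks c B) where
  unitary l k := by
    rw [Fintype.sum_sum_type]
    rcases l with l | l <;> rcases k with k | k <;>
      simp [_root_.sumBlocks, h.unitary, apply_ite conjTranspose]
  commute l k := by
    rcases l with l | l <;> rcases k with k | k <;> simp [_root_.sumBlocks, h.commute]
    rintro rfl
    simp

omit [DecidableEq b] in
theorem krausMixture_sumBlocks (w : b → ℂ) (B : b → b → Matrix (Fin n) (Fin n) ℂ) :
    krausMixture (Sum.elim w 0) (sumBlocks c B) = krausMixture w B := by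
  have key (k : b) : krausMap (sumBlocks c B) (.inl k) = krausMap B k := by
    ext1 A
    rw [krausMap_apply, krausMap_apply, Fintype.sum_sum_type]
    simp [sumBlocks]
  ext1 A
  simp [krausMixture_apply, Fintype.sum_sum_type, key]

/-- The blocks obtained from `B` when the bath level `k` is replaced by `N k` copies of it. -/
def amplify (N : b → ℕ) (B : b → b → Matrix (Fin n) (Fin n) ℂ)
    (l k : Σ k : b, Fin (N k)) : Matrix (Fin n) (Fin n) ℂ :=
  if (l.2 : ℕ) = k.2 then B l.1 k.1 else 0

theorem Fin.sum_ite_eq_val {R : Type*} [AddCommMonoid R] {N : ℕ} {a : ℕ} (f : R)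
    (h : f ≠ 0 → a < N) :
    ∑ x : Fin N, (if a = x then f else 0) = f := by
  by_cases hf : f = 0
  · simp [hf]
  · rw [Finset.sum_eq_single ⟨a, h hf⟩]
    · simp
    · intro x _ hx
      exact if_neg fun hax => hx (Fin.ext hax.symm)
    · simp

/-- Copies couple only when their indices agree; `hN` ensures that copy `x` of one level meets a
copy `x` of each level coupled to it, so no block is lost. -/
theorem IsEnergyConserving.amplify {e : b → ℝ} {B : b → b → Matrix (Fin n) (Fin n) ℂ}
    (h : IsEnergyConserving HS e B) {N : b → ℕ} (hN : ∀ l k, B l k ≠ 0 → N l = N k) :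
    IsEnergyConserving HS (fun k : Σ k : b, Fin (N k) => e k.1) (amplify N B) where
  unitary l k := by
    obtain ⟨l, x⟩ := l
    obtain ⟨k, y⟩ := k
    simp only [_root_.amplify]
    rw [Fintype.sum_sigma]
    by_cases hxy : (x : ℕ) = y
    · have key (m : b) : ∑ z : Fin (N m), (if (x : ℕ) = z then B l m else 0) *
          (if (y : ℕ) = z then B k m else 0)ᴴ = B l m * (B k m)ᴴ := by
        rw [← Fin.sum_ite_eq_val (N := N m) (a := x) (B l m * (B k m)ᴴ)]
        · refine Finset.sum_congr rfl fun z _ => ?_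
          rw [← hxy]
          split_ifs <;> simp
        · intro hne
          rw [← hN l m fun h0 => hne (by rw [h0, Matrix.zero_mul])]
          exact x.2
      simp only [key]
      rw [h.unitary]
      refine if_congr ?_ rfl rfl
      constructor
      · rintro rfl
        rw [Fin.ext hxy]
      · intro h
        exact congrArg Sigma.fst h
    · rw [if_neg]
      · refine Finset.sum_eq_zero fun m _ => Finset.sum_eq_zero fun z _ => ?_
        split_ifs with h1 h2
        · exact absurd (h1.trans h2.symm) hxy
        all_goals simp
      · intro h
        obtain ⟨rfl, h⟩ := Sigma.mk.inj_iff.1 h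
        exact hxy (by rw [eq_of_heq h])
  commute l k := by
    simp only [_root_.amplify]
    split_ifs
    · exact h.commute _ _
    · simp

omit [DecidableEq b] in
theorem krausMixture_amplify (w : b → ℂ) (N : b → ℕ) (B : b → b → Matrix (Fin n) (Fin n) ℂ)
    (hN : ∀ l k, B l k ≠ 0 → N l = N k) :
    krausMixture (fun k : Σ k : b, Fin (N k) => w k.1) (amplify N B) =
      krausMixture (fun k => N k * w k) B := by
  have key (k : Σ k : b, Fin (N k)) : krausMap (amplify N B) k = krausMap B k.1 := by
    obtain ⟨k, x⟩ := k
    ext1 A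
    rw [krausMap_apply, krausMap_apply, Fintype.sum_sigma]
    refine Finset.sum_congr rfl fun l _ => ?_
    rw [← Fin.sum_ite_eq_val (N := N l) (a := x) (B l k * A * (B l k)ᴴ)]
    · refine Finset.sum_congr rfl fun z _ => ?_
      simp only [amplify, eq_comm (a := (z : ℕ))]
      split_ifs <;> simp
    · intro hne
      rw [hN l k fun h0 => hne (by rw [h0, Matrix.zero_mul, Matrix.zero_mul])]
      exact x.2
  ext1 A
  simp only [krausMixture_apply, Fintype.sum_sigma, key, Finset.sum_const, Finset.card_univ,
    Fintype.card_fin, ← Nat.cast_smul_eq_nsmul ℂ, smul_smul, smul_eq_mul]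

omit [DecidableEq b] in
theorem krausMixture_smul (w : b → ℂ) {z : ℂ} (hz : z ≠ 0)
    (B : b → b → Matrix (Fin n) (Fin n) ℂ) :
    krausMixture (fun k => z * w k) B = krausMixture w B := by
  ext1 A
  simp only [krausMixture_apply, mul_smul, ← Finset.mul_sum, ← Finset.smul_sum]
  rw [smul_smul]
  congr 1
  field_simp

omit [DecidableEq b] in
theorem tendsto_krausMixture {ι : Type*} {F : Filter ι} {w : ι → b → ℂ} {w₀ : b → ℂ}
    (hw : ∀ k, Tendsto (fun i => w i k) F (𝓝 (w₀ k))) (h0 : ∑ k, w₀ k ≠ 0)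
    (B : b → b → Matrix (Fin n) (Fin n) ℂ) :
    Tendsto (fun i => krausMixture (w i) B) F (𝓝 (krausMixture w₀ B)) := by
  unfold krausMixture
  exact ((tendsto_finsetSum _ fun k _ => hw k).inv₀ h0).smul
    (tendsto_finsetSum _ fun k _ => (hw k).smul_const _)

/-! ### Bath energies modulo the level spacing. -/

/-- A nonzero matrix that shifts the energy of `HS` by `c` forces `c` to be a multiple of the
level spacing. -/
theorem exists_int_eq_of_commutator_eq_smul (hHS : HS.IsHermitian) {E₁ ΔE : ℝ}
    (hσ : spectrum ℂ HS ⊆ Set.range fun j : ℕ => ((E₁ + j * ΔE : ℝ) : ℂ))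
    {X : Matrix (Fin n) (Fin n) ℂ} (hX : X ≠ 0) {x : ℝ} (h : HS * X - X * HS = (x : ℂ) • X) :
    ∃ z : ℤ, x = z * ΔE := by
  have hj (i : Fin n) : ∃ j : ℕ, E₁ + j * ΔE = hHS.eigenvalues i := by
    have : (hHS.eigenvalues i : ℂ) ∈ spectrum ℂ HS := by
      rw [hHS.spectrum_eq_image_range]
      exact ⟨_, ⟨i, rfl⟩, rfl⟩
    obtain ⟨j, hj⟩ := hσ this
    exact ⟨j, Complex.ofReal_injective hj⟩
  have hspec := hHS.spectral_theorem
  set V : Matrix (Fin n) (Fin n) ℂ := hHS.eigenvectorUnitary.1 with hVdef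
  set D : Matrix (Fin n) (Fin n) ℂ := diagonal fun k => (hHS.eigenvalues k : ℂ) with hD
  have hV : V ∈ unitaryGroup (Fin n) ℂ := hHS.eigenvectorUnitary.2
  have hVr : V * Vᴴ = 1 := mem_unitaryGroup_iff.1 hV
  have hVl : Vᴴ * V = 1 := mem_unitaryGroup_iff'.1 hV
  have hspec' : HS = V * D * Vᴴ := hspec
  have h1 : D * (Vᴴ * X * V) - Vᴴ * X * V * D = (x : ℂ) • (Vᴴ * X * V) := by
    have e1 : Vᴴ * HS = D * Vᴴ := by
      rw [hspec', ← Matrix.mul_assoc, ← Matrix.mul_assoc, hVl, Matrix.one_mul]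
    have e2 : HS * V = V * D := by
      rw [hspec', Matrix.mul_assoc, hVl, Matrix.mul_one]
    calc D * (Vᴴ * X * V) - Vᴴ * X * V * D
        = (D * Vᴴ) * X * V - Vᴴ * X * (V * D) := by simp only [Matrix.mul_assoc]
      _ = Vᴴ * (HS * X - X * HS) * V := by
        rw [← e1, ← e2, Matrix.mul_sub, Matrix.sub_mul]; simp only [Matrix.mul_assoc]
      _ = _ := by rw [h]; simp
  have hY : Vᴴ * X * V ≠ 0 := fun h0 => hX <| by
    calc X = (V * Vᴴ) * X * (V * Vᴴ) := by simp [hVr]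
      _ = V * (Vᴴ * X * V) * Vᴴ := by simp only [Matrix.mul_assoc]
      _ = 0 := by rw [h0]; simp
  have : ∃ i j, (Vᴴ * X * V) i j ≠ 0 := by
    by_contra! h0
    exact hY (Matrix.ext h0)
  obtain ⟨i, j, hij⟩ := this
  have h2 := congrFun (congrFun h1 i) j
  rw [Matrix.sub_apply, hD, diagonal_mul, mul_diagonal, Matrix.smul_apply, smul_eq_mul,
    mul_comm _ (hHS.eigenvalues j : ℂ), ← sub_mul] at h2
  have h3 := mul_right_cancel₀ hij h2
  obtain ⟨p, hp⟩ := hj i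
  obtain ⟨q, hq⟩ := hj j
  refine ⟨p - q, ?_⟩
  rw [← Complex.ofReal_sub, Complex.ofReal_inj] at h3
  rw [← h3, ← hp, ← hq]
  push_cast
  ring

theorem IsEnergyConserving.exists_levels (hHS : HS.IsHermitian) {E₁ ΔE : ℝ} (hΔE : 0 < ΔE)
    (hσ : spectrum ℂ HS ⊆ Set.range fun j : ℕ => ((E₁ + j * ΔE : ℝ) : ℂ))
    {e : b → ℝ} {B : b → b → Matrix (Fin n) (Fin n) ℂ} (h : IsEnergyConserving HS e B) :
    ∃ (E : b → ℕ) (r : b → ℝ), (∀ k, e k = r k + (E k + 1) * ΔE) ∧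
      ∀ l k, B l k ≠ 0 → r l = r k := by
  -- One common shift `L` makes all ladder indices natural numbers, while `r k` still depends only
  -- on `e k` modulo `ΔE`.
  obtain ⟨L, hL⟩ := (Set.finite_range fun k => ⌊e k / ΔE⌋).bddBelow
  have hL (k) : L ≤ ⌊e k / ΔE⌋ := hL ⟨k, rfl⟩
  have hE (k) : ((⌊e k / ΔE⌋ - L).toNat : ℝ) = ⌊e k / ΔE⌋ - L := by
    rw [← Int.cast_natCast, Int.toNat_of_nonneg (by linarith [hL k])]
    push_cast
    rfl
  refine ⟨fun k => (⌊e k / ΔE⌋ - L).toNat,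
    fun k => e k - ((⌊e k / ΔE⌋ - L).toNat + 1) * ΔE, fun k => by ring, fun l k hlk => ?_⟩
  have hc := h.commute l k
  rw [← Complex.ofReal_sub] at hc
  obtain ⟨z, hz⟩ := exists_int_eq_of_commutator_eq_smul hHS hσ hlk hc
  have hfl : ⌊e k / ΔE⌋ = ⌊e l / ΔE⌋ + z := by
    rw [← Int.floor_add_intCast]
    congr 1
    field_simp
    linarith
  simp only [hE]
  rw [hfl]
  push_cast
  linarith

/-! ### Approximation by spin baths and conclusion. -/

theorem IsEnergyConserving.mem_closure_spinThermalOperations [Nonempty b] (hHS : HS.IsHermitian)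
    {E₁ ΔE : ℝ} (hΔE : 0 < ΔE)
    (hσ : spectrum ℂ HS ⊆ Set.range fun j : ℕ => ((E₁ + j * ΔE : ℝ) : ℂ))
    {e : b → ℝ} {B : b → b → Matrix (Fin n) (Fin n) ℂ} (h : IsEnergyConserving HS e B) :
    krausMixture (fun k => (boltzmann T e k : ℂ)) B ∈ closure (spinThermalOperations HS ΔE T) := by
  obtain ⟨E, r, he, hr⟩ := h.exists_levels hHS hΔE hσ
  obtain ⟨J, hJ0, hJ⟩ : ∃ J, 0 < J ∧ ∀ k, E k < J := by
    obtain ⟨J, hJ⟩ := (Set.finite_range E).bddAbove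
    exact ⟨J + 1, J.succ_pos, fun k => Nat.lt_succ_of_le (hJ ⟨k, rfl⟩)⟩
  let E' : b ⊕ Fin J → Fin J := Sum.elim (fun k => ⟨E k, hJ k⟩) id
  have h1 : IsEnergyConserving HS (fun k => ((E k : ℕ) + 1) * ΔE) B := by
    refine ⟨h.unitary, fun l k => ?_⟩
    by_cases hB : B l k = 0
    · simp [hB]
    · rw [h.commute, he, he, hr l k hB]
      push_cast
      congr 1
      ring
  have h2 : IsEnergyConserving HS (fun k => ((E' k : ℕ) + 1) * ΔE)
      (_root_.sumBlocks (Fin J) B) := by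
    convert h1.sumBlocks (fun k : Fin J => ((k : ℕ) + 1) * ΔE) using 1
    funext k
    rcases k with k | k <;> rfl
  -- `x k` is the lost Boltzmann factor and `⌈x k * M⌉₊ / M` its rational approximation; each idle
  -- level keeps one copy.
  let x (k : b) : ℝ := Real.exp (-(T⁻¹.toReal * r k))
  let N (M : ℕ) : b ⊕ Fin J → ℕ := Sum.elim (fun k => ⌈x k * M⌉₊) 1
  have hN (M : ℕ) (l k) (hlk : _root_.sumBlocks (Fin J) B l k ≠ 0) : N M l = N M k := by
    rcases l with l | l <;> rcases k with k | k
    · simp only [N, x, Sum.elim_inl, hr l k hlk]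
    · exact absurd rfl hlk
    · exact absurd rfl hlk
    · rfl
  let w (k : b ⊕ Fin J) : ℝ := boltzmann T (fun k => ((E' k : ℕ) + 1) * ΔE) k
  have hmem (M : ℕ) : krausMixture (fun k => (N M k : ℂ) * w k) (_root_.sumBlocks (Fin J) B) ∈
      spinThermalOperations HS ΔE T := by
    rw [← krausMixture_amplify (fun k => (w k : ℂ)) _ _ (hN M)]
    have hsurj : Function.Surjective fun k : (Σ k, Fin (N M k)) => E' k.1 :=
      fun j => ⟨⟨.inr j, ⟨0, Nat.one_pos⟩⟩, rfl⟩
    exact (h2.amplify (hN M)).mem_spinThermalOperations hJ0 hsurj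
  rw [← krausMixture_sumBlocks (c := Fin J)]
  refine mem_closure_of_tendsto (b := atTop)
    (f := fun M : ℕ => krausMixture (fun k => (N M k : ℂ) * w k) (_root_.sumBlocks (Fin J) B))
    ?_ (.of_forall hmem)
  -- Mixtures ignore a common factor of the weights, so these may be divided by `M`; the idle
  -- weights then tend to `0`.
  have hlim : Tendsto (fun M : ℕ => krausMixture (fun k => (M : ℂ)⁻¹ * ((N M k : ℂ) * w k))
      (_root_.sumBlocks (Fin J) B)) atTop
      (𝓝 (krausMixture (Sum.elim (fun k => (boltzmann T e k : ℂ)) 0)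
        (_root_.sumBlocks (Fin J) B))) := by
    refine tendsto_krausMixture (fun k => ?_) ?_ _
    · rcases k with k | k
      · have hx : Tendsto (fun M : ℕ => (⌈x k * M⌉₊ / M * w (.inl k) : ℝ)) atTop
            (𝓝 (x k * w (.inl k))) :=
          ((tendsto_nat_ceil_mul_div_atTop (Real.exp_nonneg _)).comp
            tendsto_natCast_atTop_atTop).mul_const _
        have hxw : x k * w (.inl k) = boltzmann T e k := by
          simp only [x, w, boltzmann, ← Real.exp_add, he k]
          congr 1
          simp only [E', Sum.elim_inl]
          ring
        rw [hxw] at hx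
        refine (Complex.continuous_ofReal.continuousAt.tendsto.comp hx).congr fun M => ?_
        simp only [Function.comp_apply, N, Sum.elim_inl]
        push_cast
        ring
      · simp only [N, Sum.elim_inr, Pi.one_apply, Nat.cast_one, one_mul, Pi.zero_apply]
        have := (tendsto_inv_atTop_nhds_zero_nat (𝕜 := ℂ)).mul_const (w (.inr k) : ℂ)
        rwa [zero_mul] at this
    · rw [Fintype.sum_sum_type]
      simpa using boltzmann_sum_ne_zero T e
  refine hlim.congr' ?_
  filter_upwards [eventually_ne_atTop 0] with M hM
  exact krausMixture_smul _ (inv_ne_zero (Nat.cast_ne_zero.2 hM)) _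

theorem spinThermalOperations_subset_withGaps (HS : Matrix (Fin n) (Fin n) ℂ) (ΔE : ℝ)
    (T : ℝ≥0∞) : spinThermalOperations HS ΔE T ⊆ spinThermalOperationsWithGaps HS ΔE T := by
  rintro S ⟨m, β, hm, hβ, hS⟩
  exact ⟨m, β, hm, Finset.sum_pos (fun j _ => hβ j) ⟨⟨0, hm⟩, Finset.mem_univ _⟩, hS⟩

theorem spinThermalOperationsWithGaps_subset_thermalOperations (HS : Matrix (Fin n) (Fin n) ℂ)
    (ΔE : ℝ) (T : ℝ≥0∞) : spinThermalOperationsWithGaps HS ΔE T ⊆ thermalOperations HS T := by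
  rintro S ⟨m, β, hm, hβ, hS⟩
  obtain ⟨B, hB, rfl⟩ := mem_spinBathOperations_iff.1 hS
  have : Nonempty (Σ j : Fin m, Fin (β j)) := by
    rw [← Fintype.card_pos_iff]
    simpa using hβ
  exact hB.mem_thermalOperations

theorem thermalOperations_subset_closure_spinThermalOperations (hHS : HS.IsHermitian)
    {E₁ ΔE : ℝ} (hΔE : 0 < ΔE)
    (hσ : spectrum ℂ HS ⊆ Set.range fun j : ℕ => ((E₁ + j * ΔE : ℝ) : ℂ)) :
    thermalOperations HS T ⊆ closure (spinThermalOperations HS ΔE T) := by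
  intro S hS
  obtain ⟨m, e, B, hm, hB, rfl⟩ := exists_isEnergyConserving_of_mem_thermalOperations hS
  have : NeZero m := ⟨hm.ne'⟩
  exact hB.mem_closure_spinThermalOperations hHS hΔE hσ

end

theorem corollary1 {n : ℕ} (HS : Matrix (Fin n) (Fin n) ℂ) (hHS : HS.IsHermitian)
    (E₁ ΔE : ℝ) (hΔE : 0 < ΔE)
    (hσ : spectrum ℂ HS ⊆ Set.range fun j : ℕ => ((E₁ + j * ΔE : ℝ) : ℂ))
    (T : ℝ≥0∞) (hT : 0 < T) :
    closure (spinThermalOperations HS ΔE T) = closure (spinThermalOperationsWithGaps HS ΔE T) ∧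
    closure (thermalOperations HS T) = closure (spinThermalOperations HS ΔE T) := by
  have h1 := closure_mono (spinThermalOperations_subset_withGaps HS ΔE T)
  have h2 := closure_mono (spinThermalOperationsWithGaps_subset_thermalOperations HS ΔE T)
  have h3 : closure (thermalOperations HS T) ⊆ closure (spinThermalOperations HS ΔE T) :=
    closure_minimal (thermalOperations_subset_closure_spinThermalOperations hHS hΔE hσ)
      isClosed_closure
  exact ⟨h1.antisymm (h2.trans h3), h3.antisymm (h1.trans h2)⟩
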